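/- Let $T\in\{-1,0,1\}^{k\times n}$ be a totally unimodular matrix (every square submatrix has determinant in $\{-1,0,1\}$), let $b\in\mathbb{Z}^k$, and let $I\subseteq[n]$ be a subset of the column indices. Let $Q\subseteq\mathbb{R}^I$ be the axis-parallel projection of $P:=\{x\in\mathbb{R}^n : Tx\le b\}$ on the variables $(x_i)_{i\in I}$, that is, $Q=\{(x_i)_{i\in I} : x\in P\}$. Call $v\in\mathbb{Z}^I$ an edge direction of $Q$ if the greatest common divisor of its components is $1$ and there are integral points $x_1,x_2\in\mathbb{Z}^I$ on a common edge ($1$-dimensional face, where $Q$ counts as a face of itself) of $Q$ with $x_1=x_2+v$. Call $w\in\mathbb{Z}^n$ TU-appendable to $T$ if the matrix $\begin{pmatrix}T\\ w^\top\end{pmatrix}$ is totally unimodular. Then for every edge direction $v\in\mathbb{Z}^I$ of $Q$ and every $w\in\mathbb{Z}^n$ that is TU-appendable to $T$ and supported on $I$ (i.e. $w_i=0$ for $i\notin I$), we have $$w_I^\top v=\sum_{i\in I} w_i v_i\in\{-1,0,1\}.$$ -/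

import Mathlib

open Matrix

namespace TUProjection

/-- The polyhedron `{x ∈ ℝⁿ : T x ≤ b}` of an integral system of linear inequalities. -/
def polyhedron {k n : ℕ} (T : Matrix (Fin k) (Fin n) ℤ) (b : Fin k → ℤ) : Set (Fin n → ℝ) :=
  {x | ∀ i, (T.map (Int.cast : ℤ → ℝ) *ᵥ x) i ≤ (b i : ℝ)}

/-- The axis-parallel projection of `P ⊆ ℝⁿ` on the variables `(x_i)_{i ∈ I}`. -/
def axisProjection {n : ℕ} (I : Finset (Fin n)) (P : Set (Fin n → ℝ)) : Set (I → ℝ) :=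
  (fun x (i : I) => x i) '' P

/-- `d` is TU-appendable to `T` if `T` with the additional row `dᵀ` is totally unimodular. -/
def TUAppendable {k n : ℕ} (T : Matrix (Fin k) (Fin n) ℤ) (d : Fin n → ℤ) : Prop :=
  (Matrix.fromRows T (Matrix.replicateRow Unit d)).IsTotallyUnimodular

/-- An edge of a polyhedron `Q` is a face of dimension one. A (nonempty) face is the set of
maximizers over `Q` of some linear functional; the zero functional gives `Q` itself. -/
def IsEdge {ι : Type*} [Fintype ι] (Q F : Set (ι → ℝ)) : Prop :=
  IsExposed ℝ Q F ∧ Module.finrank ℝ (vectorSpan ℝ F) = 1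

/-- An edge direction of `Q`: an integral vector with coprime components that is the difference
of two integral points on a common edge of `Q`. -/
def IsEdgeDirection {ι : Type*} [Fintype ι] (Q : Set (ι → ℝ)) (v : ι → ℤ) : Prop :=
  Finset.univ.gcd v = 1 ∧
    ∃ F : Set (ι → ℝ), IsEdge Q F ∧
      ∃ x₁ x₂ : ι → ℤ, (fun i => (x₁ i : ℝ)) ∈ F ∧ (fun i => (x₂ i : ℝ)) ∈ F ∧ x₁ = x₂ + v

end TUProjection

/-
Let `γ` be an integer between the values of `w` at the two integral points `x₂` and `x₂ + v` of an
edge `F`. The constraint `w x = γ` cuts a nonempty face out of the polyhedron `T x ≤ b, w x = γ`,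
whose matrix is totally unimodular because `w` is appendable. By Hoffman and Kruskal that face
contains an integral point, which projects to an integral `z ∈ F` with `w z = γ`. As `v` is
primitive, `z - x₂ = t v` for an integer `t`. Choosing `γ = w x₂ + sign (w v)` gives
`t (w v) = sign (w v)`, so `w v` divides its own sign.
-/

namespace TUProjection

open scoped Topology

section Exposed

variable {𝕜 E F : Type*} [TopologicalSpace 𝕜] [Semiring 𝕜] [Preorder 𝕜] [AddCommMonoid E]
  [TopologicalSpace E] [Module 𝕜 E] [AddCommMonoid F] [TopologicalSpace F] [Module 𝕜 F]

lemma isExposed_inter_of_subset {A B G : Set E} (hG : IsExposed 𝕜 A G) (hBA : B ⊆ A) :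
    IsExposed 𝕜 B (G ∩ B) := by
  rintro ⟨g, hgG, hgB⟩
  obtain ⟨l, rfl⟩ := hG ⟨g, hgG⟩
  refine ⟨l, Set.Subset.antisymm (fun x hx => ⟨hx.2, fun y hy => hx.1.2 y (hBA hy)⟩) ?_⟩
  exact fun x hx => ⟨⟨hBA hx.1, fun y hy => (hgG.2 y hy).trans (hx.2 g hgB)⟩, hx.1⟩

lemma isExposed_inter_preimage (f : E →L[𝕜] F) {A : Set E} {B : Set F}
    (hB : IsExposed 𝕜 (f '' A) B) : IsExposed 𝕜 A (A ∩ f ⁻¹' B) := by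
  rintro ⟨x, -, hxB⟩
  obtain ⟨l, rfl⟩ := hB ⟨f x, hxB⟩
  refine ⟨l.comp f, Set.ext fun y => and_congr_right fun hy => ?_⟩
  exact (and_iff_right (Set.mem_image_of_mem f hy)).trans Set.forall_mem_image

end Exposed

section IntervalPolyhedron

variable {m m' n : Type*} [Fintype n]

/-- The polyhedron `{x | l ≤ A x ≤ u}` of a two-sided system of linear inequalities. -/
def intervalPolyhedron (A : Matrix m n ℝ) (l u : m → ℝ) : Set (n → ℝ) :=
  {x | A *ᵥ x ∈ Set.Icc l u}

lemma isClosed_intervalPolyhedron (A : Matrix m n ℝ) (l u : m → ℝ) :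
    IsClosed (intervalPolyhedron A l u) :=
  isClosed_Icc.preimage (by fun_prop)

lemma mem_intervalPolyhedron_map_fromRows {A : Matrix m n ℤ} {B : Matrix m' n ℤ} {l u : m → ℤ}
    {l' u' : m' → ℤ} {x : n → ℝ} :
    x ∈ intervalPolyhedron ((fromRows A B).map Int.cast) (Int.cast ∘ Sum.elim l l')
        (Int.cast ∘ Sum.elim u u') ↔
      x ∈ intervalPolyhedron (A.map Int.cast) (Int.cast ∘ l) (Int.cast ∘ u) ∧
        x ∈ intervalPolyhedron (B.map Int.cast) (Int.cast ∘ l') (Int.cast ∘ u') := by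
  simp only [intervalPolyhedron, Set.mem_ofPred_eq, fromRows_map, fromRows_mulVec, Sum.comp_elim,
    Set.mem_Icc, Sum.elim_le_elim_iff]
  tauto

lemma eventually_add_smul_mem_intervalPolyhedron [Finite m] {A : Matrix m n ℝ} {l u : m → ℝ}
    {x d : n → ℝ} (hx : x ∈ intervalPolyhedron A l u)
    (hd : ∀ i, (A *ᵥ x) i = l i ∨ (A *ᵥ x) i = u i → (A *ᵥ d) i = 0) :
    ∀ᶠ ε in 𝓝 (0 : ℝ), x + ε • d ∈ intervalPolyhedron A l u := by
  have hrow : ∀ i, ∀ᶠ ε in 𝓝 (0 : ℝ), (A *ᵥ x) i + ε * (A *ᵥ d) i ∈ Set.Icc (l i) (u i) := by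
    intro i
    have hmem : (A *ᵥ x) i ∈ Set.Icc (l i) (u i) := ⟨hx.1 i, hx.2 i⟩
    by_cases htight : (A *ᵥ x) i = l i ∨ (A *ᵥ x) i = u i
    · simpa [hd i htight] using hmem
    · rw [not_or] at htight
      have hcont : ContinuousAt (fun ε : ℝ => (A *ᵥ x) i + ε * (A *ᵥ d) i) 0 := by fun_prop
      refine hcont.eventually_mem (Icc_mem_nhds ?_ ?_)
      · simpa using lt_of_le_of_ne hmem.1 (Ne.symm htight.1)
      · simpa using lt_of_le_of_ne hmem.2 htight.2
  filter_upwards [Filter.eventually_all.2 hrow] with ε hε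
  simp only [intervalPolyhedron, Set.mem_ofPred_eq, mulVec_add, mulVec_smul]
  exact ⟨fun i => (hε i).1, fun i => (hε i).2⟩

lemma eq_zero_of_mem_extremePoints_intervalPolyhedron [Finite m] {A : Matrix m n ℝ} {l u : m → ℝ}
    {x d : n → ℝ} (hx : x ∈ (intervalPolyhedron A l u).extremePoints ℝ)
    (hd : ∀ i, (A *ᵥ x) i = l i ∨ (A *ᵥ x) i = u i → (A *ᵥ d) i = 0) : d = 0 := by
  have hplus := eventually_add_smul_mem_intervalPolyhedron hx.1 hd
  have hminus := (continuous_neg.tendsto' (0 : ℝ) 0 neg_zero).eventually hplus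
  obtain ⟨ε, ⟨hp, hm⟩, hε⟩ :=
    (((hplus.and hminus).filter_mono nhdsWithin_le_nhds).and
      (self_mem_nhdsWithin (s := {0}ᶜ))).exists
  have hmid : x ∈ openSegment ℝ (x + ε • d) (x + -ε • d) :=
    ⟨1 / 2, 1 / 2, by norm_num, by norm_num, by norm_num, by module⟩
  simpa [show ε ≠ 0 from hε] using hx.2 hp hm hmid

end IntervalPolyhedron

section TotallyUnimodular

variable {m n : Type*} [Fintype n]

lemma exists_isUnit_submatrix_of_injective_mulVec {K : Type*} [Field K] [Finite m] [DecidableEq n]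
    {A : Matrix m n K} (hA : Function.Injective A.mulVec) :
    ∃ f : n → m, IsUnit (A.submatrix f id) := by
  obtain ⟨κ, a, -, hspan, hli⟩ := exists_linearIndependent' K A.row
  have htop : Submodule.span K (Set.range A.row) = ⊤ := by
    apply Submodule.eq_top_of_finrank_eq
    rw [← rank_eq_finrank_span_row, rank, LinearMap.finrank_range_of_inj hA]
  let e : n ≃ κ := (Pi.basisFun K n).indexEquiv (Module.Basis.mk hli (hspan.trans htop).ge)
  exact ⟨a ∘ e, linearIndependent_rows_iff_isUnit.1 (hli.comp e e.injective)⟩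

lemma isUnit_det_submatrix_of_isTotallyUnimodular {m n ι R : Type*} [Fintype ι] [DecidableEq ι]
    [CommRing R] {A : Matrix m n R} (hA : A.IsTotallyUnimodular) {f : ι → m} {g : ι → n}
    (h : (A.submatrix f g).det ≠ 0) : IsUnit (A.submatrix f g).det := by
  obtain ⟨s, hs⟩ := (isTotallyUnimodular_iff_fintype A).1 hA ι f g
  rw [← hs] at h ⊢
  cases s with
  | zero => exact absurd rfl h
  | neg => exact isUnit_one.neg
  | pos => exact isUnit_one

lemma map_intCast_mulVec {R : Type*} [Ring R] (A : Matrix m n ℤ) (z : n → ℤ) :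
    A.map (Int.cast : ℤ → R) *ᵥ (fun j => (z j : R)) = fun i => ((A *ᵥ z) i : R) :=
  funext fun i => ((Int.castRingHom R).map_mulVec A z i).symm

lemma exists_int_eq_of_isUnit_det {R : Type*} [CommRing R] [DecidableEq n] {A : Matrix n n ℤ}
    (hA : IsUnit A.det) {x : n → R} {c : n → ℤ}
    (hx : A.map (Int.cast : ℤ → R) *ᵥ x = fun i => (c i : R)) :
    ∃ z : n → ℤ, x = fun j => (z j : R) := by
  have hinv : A⁻¹.map (Int.cast : ℤ → R) * A.map (Int.cast : ℤ → R) = 1 := by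
    have h := congrArg (Int.castRingHom R).mapMatrix (nonsing_inv_mul A hA)
    rwa [map_mul, map_one] at h
  refine ⟨A⁻¹ *ᵥ c, ?_⟩
  calc x = A⁻¹.map (Int.cast : ℤ → R) *ᵥ (A.map (Int.cast : ℤ → R) *ᵥ x) := by
        rw [mulVec_mulVec, hinv, one_mulVec]
    _ = fun j => ((A⁻¹ *ᵥ c) j : R) := by rw [hx, map_intCast_mulVec]

lemma exists_int_eq_of_integral_rows [Finite m] {K : Type*} [Field K] {A : Matrix m n ℤ}
    (hA : A.IsTotallyUnimodular) {x : n → K}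
    (hx : ∀ d, (∀ i, (A.map (Int.cast : ℤ → K) *ᵥ x) i ∈ Set.range (Int.cast : ℤ → K) →
      (A.map (Int.cast : ℤ → K) *ᵥ d) i = 0) → d = 0) :
    ∃ z : n → ℤ, x = fun j => (z j : K) := by
  classical
  let J := {i // (A.map (Int.cast : ℤ → K) *ᵥ x) i ∈ Set.range (Int.cast : ℤ → K)}
  let AJ : Matrix J n ℤ := A.submatrix Subtype.val id
  have hinj : Function.Injective (AJ.map (Int.cast : ℤ → K)).mulVec :=
    (injective_iff_map_eq_zero (AJ.map (Int.cast : ℤ → K)).mulVecLin).2 fun d hd =>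
      hx d fun i hi => congrFun hd ⟨i, hi⟩
  obtain ⟨f, hf⟩ := exists_isUnit_submatrix_of_injective_mulVec hinj
  let C : Matrix n n ℤ := AJ.submatrix f id
  have hdet : ((C.det : ℤ) : K) ≠ 0 := by
    have hunit : IsUnit ((Int.castRingHom K).mapMatrix C).det := (isUnit_iff_isUnit_det _).1 hf
    rw [← RingHom.map_det] at hunit
    exact hunit.ne_zero
  choose c hc using fun j => (f j).2
  exact exists_int_eq_of_isUnit_det
    (isUnit_det_submatrix_of_isTotallyUnimodular (hA.submatrix Subtype.val id)
      fun h0 => hdet (by rw [show C.det = 0 from h0, Int.cast_zero]))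
    (funext fun j => (hc j).symm)

lemma exists_int_eq_of_mem_extremePoints [Finite m] {A : Matrix m n ℤ}
    (hA : A.IsTotallyUnimodular) {l u : m → ℤ} {x : n → ℝ}
    (hx : x ∈ (intervalPolyhedron (A.map Int.cast) (Int.cast ∘ l)
      (Int.cast ∘ u)).extremePoints ℝ) :
    ∃ z : n → ℤ, x = fun j => (z j : ℝ) := by
  refine exists_int_eq_of_integral_rows hA fun d hd =>
    eq_zero_of_mem_extremePoints_intervalPolyhedron hx ?_
  rintro i (h | h)
  exacts [hd i ⟨l i, h.symm⟩, hd i ⟨u i, h.symm⟩]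

/- The unit box around a point of the face cuts out a compact polyhedron with the same kind of
matrix, and the face of that polyhedron has an extreme point. -/
theorem exists_int_mem_of_isExposed_intervalPolyhedron [Finite m] {A : Matrix m n ℤ}
    (hA : A.IsTotallyUnimodular) {l u : m → ℤ} {G : Set (n → ℝ)}
    (hG : IsExposed ℝ (intervalPolyhedron (A.map Int.cast) (Int.cast ∘ l)
      (Int.cast ∘ u)) G) (hne : G.Nonempty) :
    ∃ z : n → ℤ, (fun j => (z j : ℝ)) ∈ G := by
  classical
  obtain ⟨p, hp⟩ := hne
  let Q : Set (n → ℝ) := intervalPolyhedron ((fromRows A 1).map Int.cast)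
    (Int.cast ∘ Sum.elim l (fun j => ⌊p j⌋)) (Int.cast ∘ Sum.elim u (fun j => ⌈p j⌉))
  have mem_Q {x} : x ∈ Q ↔ x ∈ intervalPolyhedron (A.map Int.cast) (Int.cast ∘ l) (Int.cast ∘ u) ∧
      x ∈ Set.Icc (Int.cast ∘ fun j => ⌊p j⌋) (Int.cast ∘ fun j => ⌈p j⌉) := by
    refine mem_intervalPolyhedron_map_fromRows.trans (and_congr_right fun _ => ?_)
    rw [intervalPolyhedron, Set.mem_ofPred_eq, Matrix.map_one _ Int.cast_zero Int.cast_one,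
      one_mulVec]
  have hpQ : p ∈ Q :=
    mem_Q.2 ⟨hG.subset hp, fun j => Int.floor_le (p j), fun j => Int.le_ceil (p j)⟩
  have hQ : IsCompact Q := isCompact_Icc.of_isClosed_subset
    (isClosed_intervalPolyhedron _ _ _) fun x hx => (mem_Q.1 hx).2
  have hGQ : IsExposed ℝ Q (G ∩ Q) := isExposed_inter_of_subset hG fun x hx => (mem_Q.1 hx).1
  obtain ⟨e, he⟩ := (hGQ.isCompact hQ).extremePoints_nonempty ⟨p, hp, hpQ⟩
  obtain ⟨z, rfl⟩ := exists_int_eq_of_mem_extremePoints hA.fromRows_one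
    (hGQ.isExtreme.extremePoints_subset_extremePoints he)
  exact ⟨z, he.1.1⟩

end TotallyUnimodular

section Projection

variable {k n : ℕ} {T : Matrix (Fin k) (Fin n) ℤ} {b : Fin k → ℤ} {w : Fin n → ℤ}

lemma convex_polyhedron (T : Matrix (Fin k) (Fin n) ℤ) (b : Fin k → ℤ) :
    Convex ℝ (polyhedron T b) :=
  (convex_Iic fun i => (b i : ℝ)).linear_preimage (T.map (Int.cast : ℤ → ℝ)).mulVecLin

theorem exists_int_mem_dotProduct_eq (hw : TUAppendable T w) {G : Set (Fin n → ℝ)}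
    (hG : IsExposed ℝ (polyhedron T b) G) {p q : Fin n → ℝ} (hp : p ∈ G) (hq : q ∈ G) {γ : ℤ}
    (hγ : (γ : ℝ) ∈ Set.uIcc ((fun i => (w i : ℝ)) ⬝ᵥ p) ((fun i => (w i : ℝ)) ⬝ᵥ q)) :
    ∃ z : Fin n → ℤ, (fun i => (z i : ℝ)) ∈ G ∧ w ⬝ᵥ z = γ := by
  obtain ⟨y, hyG, hyγ⟩ : (γ : ℝ) ∈ (fun x => (fun i => (w i : ℝ)) ⬝ᵥ x) '' G :=
    ((hG.convex (convex_polyhedron T b)).is_linear_image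
      ⟨dotProduct_add _, fun c x => dotProduct_smul c _ x⟩).ordConnected.uIcc_subset
      ⟨p, hp, rfl⟩ ⟨q, hq, rfl⟩ hγ
  /- The row `w` becomes the equation `w x = γ`. Any integral lower bounds that hold at `y` would do
  for the other rows. -/
  let W : Matrix Unit (Fin n) ℤ := replicateRow Unit w
  let l : Fin k ⊕ Unit → ℤ := Sum.elim (fun i => ⌊(T.map (Int.cast : ℤ → ℝ) *ᵥ y) i⌋) fun _ => γ
  let u : Fin k ⊕ Unit → ℤ := Sum.elim b fun _ => γ
  let S : Set (Fin n → ℝ) :=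
    intervalPolyhedron ((fromRows T W).map Int.cast) (Int.cast ∘ l) (Int.cast ∘ u)
  have hyS : y ∈ S := mem_intervalPolyhedron_map_fromRows.2
    ⟨⟨fun i => Int.floor_le _, hG.subset hyG⟩, fun _ => hyγ.ge, fun _ => hyγ.le⟩
  have hSP : S ⊆ polyhedron T b := fun x hx => (mem_intervalPolyhedron_map_fromRows.1 hx).1.2
  obtain ⟨z, hzG, hzS⟩ := exists_int_mem_of_isExposed_intervalPolyhedron hw
    (isExposed_inter_of_subset hG hSP) ⟨y, hyG, hyS⟩
  have hzW := (mem_intervalPolyhedron_map_fromRows.1 hzS).2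
  rw [intervalPolyhedron, Set.mem_ofPred_eq, map_intCast_mulVec] at hzW
  have hwz : ((w ⬝ᵥ z : ℤ) : ℝ) = γ := le_antisymm (hzW.2 ()) (hzW.1 ())
  exact ⟨z, hzG, Int.cast_injective hwz⟩

lemma dotProduct_eq_dotProduct_restrict {ι R : Type*} [Fintype ι] [NonUnitalNonAssocSemiring R]
    {I : Finset ι} {a : ι → R} (ha : ∀ i, i ∉ I → a i = 0) (x : ι → R) :
    a ⬝ᵥ x = (fun i : I => a i) ⬝ᵥ fun i : I => x i := by
  simp only [dotProduct]
  rw [Finset.sum_coe_sort I fun i => a i * x i]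
  exact (Finset.sum_subset (Finset.subset_univ I) fun i _ hi => by rw [ha i hi, zero_mul]).symm

theorem exists_int_mem_axisProjection_dotProduct_eq {I : Finset (Fin n)} (hw : TUAppendable T w)
    (hwI : ∀ i, i ∉ I → w i = 0) {F : Set (I → ℝ)}
    (hF : IsExposed ℝ (axisProjection I (polyhedron T b)) F) {x y : I → ℝ} (hx : x ∈ F)
    (hy : y ∈ F) {γ : ℤ}
    (hγ : (γ : ℝ) ∈ Set.uIcc ((fun i : I => (w i : ℝ)) ⬝ᵥ x) ((fun i : I => (w i : ℝ)) ⬝ᵥ y)) :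
    ∃ z : I → ℤ, (fun i => (z i : ℝ)) ∈ F ∧ (fun i : I => w i) ⬝ᵥ z = γ := by
  let π : (Fin n → ℝ) →L[ℝ] (I → ℝ) := .pi fun i : I => .proj (i : Fin n)
  have hwI' : ∀ i, i ∉ I → (w i : ℝ) = 0 := fun i hi => by rw [hwI i hi, Int.cast_zero]
  obtain ⟨p, hpP, rfl⟩ := hF.subset hx
  obtain ⟨q, hqP, rfl⟩ := hF.subset hy
  rw [← dotProduct_eq_dotProduct_restrict hwI', ← dotProduct_eq_dotProduct_restrict hwI'] at hγ
  obtain ⟨z, hzG, hz⟩ := exists_int_mem_dotProduct_eq hw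
    (isExposed_inter_preimage π hF) ⟨hpP, hx⟩ ⟨hqP, hy⟩ hγ
  exact ⟨fun i => z i, hzG.2, by rw [← dotProduct_eq_dotProduct_restrict hwI, hz]⟩

end Projection

section EdgeDirection

variable {ι : Type*} [Fintype ι]

lemma exists_int_smul_eq_of_gcd_eq_one {R : Type*} [CommRing R] [CharZero R] {v u : ι → ℤ}
    (hv : Finset.univ.gcd v = 1) {s : R} (h : ∀ i, s * v i = u i) : ∃ t : ℤ, u = t • v := by
  obtain ⟨g, hg⟩ := Finset.univ.gcd_eq_sum_mul v
  have hs : s = ((∑ i, u i * g i : ℤ) : R) := by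
    calc s = s * ((∑ i, v i * g i : ℤ) : R) := by rw [← hg, hv, Int.cast_one, mul_one]
      _ = ((∑ i, u i * g i : ℤ) : R) := by
        push_cast
        simp only [Finset.mul_sum, ← mul_assoc, h]
  refine ⟨∑ i, u i * g i, funext fun i => Int.cast_injective (α := R) ?_⟩
  rw [← h i, hs, Pi.smul_apply, smul_eq_mul, Int.cast_mul]

lemma exists_int_smul_eq_sub_of_finrank_vectorSpan_eq_one {F : Set (ι → ℝ)}
    (hF : Module.finrank ℝ (vectorSpan ℝ F) = 1) {x v z : ι → ℤ} (hv : Finset.univ.gcd v = 1)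
    (hx : (fun i => (x i : ℝ)) ∈ F) (hxv : (fun i => ((x + v) i : ℝ)) ∈ F)
    (hz : (fun i => (z i : ℝ)) ∈ F) : ∃ t : ℤ, z - x = t • v := by
  have hv0 : (fun i => ((x + v) i : ℝ)) -ᵥ (fun i => (x i : ℝ)) ≠ 0 := by
    intro h
    have hvz : v = 0 := funext fun i => by simpa using congrFun h i
    exact zero_ne_one ((Finset.gcd_eq_zero_iff.2 fun i _ => congrFun hvz i).symm.trans hv)
  obtain ⟨s, hs⟩ := exists_smul_eq_of_finrank_eq_one hF
    (x := ⟨_, vsub_mem_vectorSpan ℝ hxv hx⟩) (by simpa only [ne_eq, Submodule.mk_eq_zero] using hv0)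
    ⟨_, vsub_mem_vectorSpan ℝ hz hx⟩
  refine exists_int_smul_eq_of_gcd_eq_one hv (s := s) fun i => ?_
  simpa using congrFun (congrArg Subtype.val hs) i

end EdgeDirection

lemma add_sign_mem_uIcc (a c : ℤ) : a + c.sign ∈ Set.uIcc a (a + c) := by
  rw [Set.mem_uIcc]
  rcases lt_trichotomy c 0 with h | rfl | h
  · rw [Int.sign_eq_neg_one_of_neg h]
    omega
  · simp
  · rw [Int.sign_eq_one_of_pos h]
    omega

lemma intCast_mem_uIcc {R : Type*} [Ring R] [LinearOrder R] [IsStrictOrderedRing R] {a b c : ℤ}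
    (h : c ∈ Set.uIcc a b) : (c : R) ∈ Set.uIcc (a : R) b := by
  rw [Set.mem_uIcc] at h ⊢
  exact_mod_cast h

lemma intCast_dotProduct {ι R : Type*} [Fintype ι] [Ring R] (a x : ι → ℤ) :
    ((a ⬝ᵥ x : ℤ) : R) = (fun i => (a i : R)) ⬝ᵥ fun i => (x i : R) :=
  (Int.castRingHom R).map_dotProduct a x

lemma mem_neg_one_zero_one_of_dvd_sign {c : ℤ} (hc : c ∣ c.sign) : c ∈ ({-1, 0, 1} : Set ℤ) := by
  rcases lt_trichotomy c 0 with h | rfl | h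
  · rw [Int.sign_eq_neg_one_of_neg h, dvd_neg] at hc
    rcases Int.isUnit_iff.1 (isUnit_of_dvd_one hc) with rfl | rfl <;> simp
  · simp
  · rw [Int.sign_eq_one_of_pos h] at hc
    rcases Int.isUnit_iff.1 (isUnit_of_dvd_one hc) with rfl | rfl <;> simp

end TUProjection

theorem theorem7 {k n : ℕ} (T : Matrix (Fin k) (Fin n) ℤ) (hT : T.IsTotallyUnimodular)
    (b : Fin k → ℤ) (I : Finset (Fin n)) (v : I → ℤ)
    (hv : TUProjection.IsEdgeDirection
      (TUProjection.axisProjection I (TUProjection.polyhedron T b)) v)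
    (w : Fin n → ℤ) (hw : TUProjection.TUAppendable T w) (hwI : ∀ i, i ∉ I → w i = 0) :
    (fun i : I => w i) ⬝ᵥ v ∈ ({-1, 0, 1} : Set ℤ) := by
  obtain ⟨hgcd, F, ⟨hF, hdim⟩, x₁, x, hx₁, hx, rfl⟩ := hv
  set c := (fun i : I => w i) ⬝ᵥ v
  have hγ : (((fun i : I => w i) ⬝ᵥ x + c.sign : ℤ) : ℝ) ∈ Set.uIcc
      ((fun i : I => (w i : ℝ)) ⬝ᵥ fun i => (x i : ℝ))
      ((fun i : I => (w i : ℝ)) ⬝ᵥ fun i => ((x + v) i : ℝ)) := by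
    rw [← TUProjection.intCast_dotProduct, ← TUProjection.intCast_dotProduct, dotProduct_add]
    exact TUProjection.intCast_mem_uIcc (TUProjection.add_sign_mem_uIcc _ c)
  obtain ⟨z, hzF, hz⟩ :=
    TUProjection.exists_int_mem_axisProjection_dotProduct_eq hw hwI hF hx hx₁ hγ
  obtain ⟨t, ht⟩ :=
    TUProjection.exists_int_smul_eq_sub_of_finrank_vectorSpan_eq_one hdim hgcd hx hx₁ hzF
  have hsign : c.sign = c * t := by
    calc c.sign = (fun i : I => w i) ⬝ᵥ (z - x) := by rw [dotProduct_sub, hz, add_sub_cancel_left]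
      _ = c * t := by rw [ht, dotProduct_smul, smul_eq_mul, mul_comm]
  exact TUProjection.mem_neg_one_zero_one_of_dvd_sign ⟨t, hsign⟩
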